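/- For a finite simple graph $F$, let $D[F]$ denote the minimum quantifier depth (the greatest length of a chain of nested quantifiers) of a first-order sentence $\varphi$ over the signature consisting of adjacency $\sim$ and equality $=$ that expresses the property of containing an induced subgraph isomorphic to $F$, i.e. such that for every finite graph $G$, $G\models\varphi$ if and only if $G$ has an induced subgraph isomorphic to $F$. Then every graph $F$ on $5$ vertices satisfies $D[F]\geq 4$. -/

import Mathlib

open FirstOrder

namespace FirstOrderComplexity

open FirstOrder.Language

/-- The quantifier depth of a formula: the greatest length of a chain of nested quantifiers. The
existential quantifier is by definition `¬ ∀ ¬`, so it counts in the same way as `∀`. -/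
def quantifierDepth {L : Language} {α : Type*} : ∀ {n : ℕ}, L.BoundedFormula α n → ℕ
  | _, .falsum => 0
  | _, .equal _ _ => 0
  | _, .rel _ _ => 0
  | _, .imp φ ψ => max (quantifierDepth φ) (quantifierDepth ψ)
  | _, .all φ => quantifierDepth φ + 1

/-- The sentence `φ`, in the language with adjacency and equality, is true on the graph `G`. -/
def Models {V : Type*} (G : SimpleGraph V) (φ : Language.graph.Sentence) : Prop :=
  letI := G.structure
  V ⊨ φ

/-- The sentence `φ` expresses the property of containing an induced subgraph isomorphic to `F`:
on every finite (nonempty) graph `G` it is true if and only if `G` has that property. -/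
def Expresses {W : Type*} (F : SimpleGraph W) (φ : Language.graph.Sentence) : Prop :=
  ∀ (V : Type) [Finite V] [Nonempty V] (G : SimpleGraph V), Models G φ ↔ F.IsIndContained G

/-- `D[F]`: the least quantifier depth of a first-order sentence that expresses the property of
containing an induced subgraph isomorphic to `F`. -/
noncomputable def inducedDepth {W : Type*} (F : SimpleGraph W) : ℕ :=
  sInf {d : ℕ | ∃ φ : Language.graph.Sentence, Expresses F φ ∧ quantifierDepth φ = d}

/-- For a finite graph `F` such sentences exist, so the minimum above is over a nonempty set. -/
theorem exists_expresses {W : Type*} [Finite W] (F : SimpleGraph W) :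
    ∃ φ : Language.graph.Sentence, Expresses F φ := by
  classical
  obtain ⟨n, ⟨e⟩⟩ := Finite.exists_equiv_fin W
  let var : Fin n → Language.graph.Term (Empty ⊕ Fin n) := fun i => Term.var (Sum.inr i)
  let lit : Fin n × Fin n → Language.graph.BoundedFormula Empty n := fun p =>
    if p.1 = p.2 then ⊤ else
      ((var p.1).bdEqual (var p.2)).not ⊓
        (if F.Adj (e.symm p.1) (e.symm p.2) then
          Relations.boundedFormula₂ (adj : Language.graph.Relations 2) (var p.1) (var p.2)
        else (Relations.boundedFormula₂ (adj : Language.graph.Relations 2)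
          (var p.1) (var p.2)).not)
  refine ⟨(BoundedFormula.iInf lit).exs, ?_⟩
  intro V _ _ G
  let := G.structure
  have hlit : ∀ (xs : Fin n → V) (p : Fin n × Fin n),
      (lit p).Realize (default : Empty → V) xs ↔
        (p.1 ≠ p.2 → xs p.1 ≠ xs p.2 ∧
          (F.Adj (e.symm p.1) (e.symm p.2) ↔ G.Adj (xs p.1) (xs p.2))) := by
    intro xs p
    have hadj : (Relations.boundedFormula₂ (adj : Language.graph.Relations 2)
        (var p.1) (var p.2)).Realize (default : Empty → V) xs ↔ G.Adj (xs p.1) (xs p.2) := by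
      rw [BoundedFormula.realize_rel₂]
      rfl
    by_cases h : p.1 = p.2
    · simp [lit, h]
    · by_cases h' : F.Adj (e.symm p.1) (e.symm p.2)
      · simp only [lit, h, h', if_true, if_false, BoundedFormula.realize_inf,
          BoundedFormula.realize_not, BoundedFormula.realize_bdEqual, hadj]
        simp [var, h]
      · simp only [lit, h, h', if_false, BoundedFormula.realize_inf,
          BoundedFormula.realize_not, BoundedFormula.realize_bdEqual, hadj]
        simp [var, h]
  have key : Models G (BoundedFormula.iInf lit).exs ↔
      ∃ xs : Fin n → V, ∀ p : Fin n × Fin n, p.1 ≠ p.2 → xs p.1 ≠ xs p.2 ∧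
          (F.Adj (e.symm p.1) (e.symm p.2) ↔ G.Adj (xs p.1) (xs p.2)) := by
    change Formula.Realize (BoundedFormula.iInf lit).exs (default : Empty → V) ↔ _
    rw [BoundedFormula.realize_exs]
    simp only [BoundedFormula.realize_iInf, hlit]
  rw [key]
  constructor
  · rintro ⟨xs, h⟩
    refine ⟨⟨⟨fun w => xs (e w), ?_⟩, ?_⟩⟩
    · intro a b hab
      by_contra hne
      exact (h (e a, e b) (fun h' => hne (e.injective h'))).1 hab
    · intro a b
      by_cases hne : a = b
      · subst hne
        simp
      · have := (h (e a, e b) (fun h' => hne (e.injective h'))).2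
        simp only [Equiv.symm_apply_apply] at this
        exact this.symm
  · rintro ⟨f⟩
    refine ⟨fun i => f (e.symm i), fun p hp => ⟨?_, ?_⟩⟩
    · intro h
      exact hp (e.symm.injective (f.injective h))
    · exact f.map_rel_iff.symm

end FirstOrderComplexity

namespace FirstOrderComplexity

open FirstOrder.Language

/-! It suffices to find, for each F, two finite graphs that no sentence of depth 3 separates, only
one of which contains F. Duplicator survives three rounds on any two graphs with a common
`HasExtensionProfile`: the first reply is free, the second needs only a neighbour or a
non-neighbour, and the third a vertex of prescribed adjacency to two others.

Every F embeds in a graph realizing all extension types, namely the pentagon with each vertex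
replaced by `F □ cycleGraph 5`. The rook's graph and the pentagon substituted into itself also
realize all types, so F is settled unless it lies in both. The rook's graph has only five induced
subgraphs on five vertices up to isomorphism. The path, the house and the bull have no nontrivial
modules and differ from the pentagon, so they are absent from the substituted pentagon. A 4-cycle
plus an isolated vertex is separated by two triangle-free graphs realizing every other type: the
circulant contains it, and the Petersen graph has no 4-cycle. Its complement is handled by
complementing both graphs. -/

/-- Duplicator wins the `k`-round Ehrenfeucht–Fraïssé game on `G` and `H` from the position in which
the vertices `xs` and `ys` are pebbled. -/
def DuplicatorWins {V V' : Type*} (G : SimpleGraph V) (H : SimpleGraph V') :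
    ∀ (_k : ℕ) {n : ℕ} (_xs : Fin n → V) (_ys : Fin n → V'), Prop
  | 0, _, xs, ys => ∀ i j, (xs i = xs j ↔ ys i = ys j) ∧ (G.Adj (xs i) (xs j) ↔ H.Adj (ys i) (ys j))
  | k + 1, _, xs, ys =>
      (∀ x, ∃ y, DuplicatorWins G H k (Fin.snoc xs x : Fin (_ + 1) → V) (Fin.snoc ys y)) ∧
      (∀ y, ∃ x, DuplicatorWins G H k (Fin.snoc xs x : Fin (_ + 1) → V) (Fin.snoc ys y))

/-! ### The game bounds what sentences of given depth can distinguish. -/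

section Game

variable {V V' : Type*} {G : SimpleGraph V} {H : SimpleGraph V'}

/-- Later rounds only lengthen the tuples, so a mismatch among the present pebbles would survive to
the end. -/
theorem DuplicatorWins.partialIso [Nonempty V] {k n : ℕ} {xs : Fin n → V} {ys : Fin n → V'}
    (h : DuplicatorWins G H k xs ys) (i j : Fin n) :
    (xs i = xs j ↔ ys i = ys j) ∧ (G.Adj (xs i) (xs j) ↔ H.Adj (ys i) (ys j)) := by
  induction k generalizing n with
  | zero => exact h i j
  | succ k ih =>
    obtain ⟨y, hy⟩ := h.1 (Classical.arbitrary V)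
    simpa using ih hy i.castSucc j.castSucc

theorem DuplicatorWins.realize_iff [Nonempty V] {n : ℕ} (φ : Language.graph.BoundedFormula Empty n)
    {k : ℕ} (hφ : quantifierDepth φ ≤ k) {xs : Fin n → V} {ys : Fin n → V'}
    (h : DuplicatorWins G H k xs ys) (v : Empty → V) (v' : Empty → V') :
    (letI := G.structure; φ.Realize v xs) ↔ (letI := H.structure; φ.Realize v' ys) := by
  let := G.structure
  let := H.structure
  -- With no function symbols and no free variables, every term is a bound variable, that is, a
  -- pebble.
  have term : ∀ {n : ℕ} (t : Language.graph.Term (Empty ⊕ Fin n)), ∃ i, t = Term.var (Sum.inr i) := by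
    intro n t
    cases t with
    | var a =>
      cases a with
      | inl a => exact a.elim
      | inr i => exact ⟨i, rfl⟩
    | func f _ => exact isEmptyElim f
  induction φ generalizing k with
  | falsum => rfl
  | equal t₁ t₂ =>
    obtain ⟨i, rfl⟩ := term t₁
    obtain ⟨j, rfl⟩ := term t₂
    simpa [BoundedFormula.Realize] using (h.partialIso i j).1
  | rel R ts =>
    cases R
    obtain ⟨i, hi⟩ := term (ts 0)
    obtain ⟨j, hj⟩ := term (ts 1)
    have := (h.partialIso i j).2
    change G.Adj ((ts 0).realize _) ((ts 1).realize _) ↔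
      H.Adj ((ts 0).realize _) ((ts 1).realize _)
    simpa [hi, hj] using this
  | imp φ ψ ihφ ihψ =>
    simp only [quantifierDepth, max_le_iff] at hφ
    exact imp_congr (ihφ hφ.1 h) (ihψ hφ.2 h)
  | all φ ih =>
    simp only [quantifierDepth] at hφ
    obtain ⟨k, rfl⟩ : ∃ k', k = k' + 1 := ⟨k - 1, by omega⟩
    have hφ' : quantifierDepth φ ≤ k := by omega
    constructor
    · intro H' y
      obtain ⟨x, hx⟩ := h.2 y
      exact (ih hφ' hx).1 (H' x)
    · intro H' x
      obtain ⟨y, hy⟩ := h.1 x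
      exact (ih hφ' hy).2 (H' y)

theorem DuplicatorWins.models_iff [Nonempty V] {φ : Language.graph.Sentence} {k : ℕ}
    (hφ : quantifierDepth φ ≤ k) (h : DuplicatorWins G H k (default : Fin 0 → V) default) :
    Models G φ ↔ Models H φ :=
  h.realize_iff φ hφ default default

end Game

/-! ### Extension profiles and three-round equivalence. -/

/-- Every vertex has a neighbour and a non-neighbour, and whether a pair of distinct vertices has a
common extension of a given adjacency type is prescribed by `P`, where `P c a b` concerns pairs with
adjacency `c` and extensions with adjacencies `a` and `b` to the two vertices. -/
structure HasExtensionProfile {V : Type*} (G : SimpleGraph V) (P : Bool → Bool → Bool → Bool) :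
    Prop where
  neighbor : ∀ u, ∃ z, G.Adj z u
  nonneighbor : ∀ u, ∃ z, z ≠ u ∧ ¬ G.Adj z u
  extension : ∀ u v, u ≠ v → ∀ c : Bool, (G.Adj u v ↔ c = true) → ∀ a b : Bool,
    ((∃ z, z ≠ u ∧ z ≠ v ∧ (G.Adj z u ↔ a = true) ∧ (G.Adj z v ↔ b = true)) ↔ P c a b = true)

namespace HasExtensionProfile

variable {V V' : Type*} {G : SimpleGraph V} {H : SimpleGraph V'} {P : Bool → Bool → Bool → Bool}

theorem exists_second (hH : HasExtensionProfile H P) (x₀ x₁ : V) (y₀ : V') :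
    ∃ y₁, (x₁ = x₀ ↔ y₁ = y₀) ∧ (G.Adj x₁ x₀ ↔ H.Adj y₁ y₀) := by
  by_cases h : x₁ = x₀
  · exact ⟨y₀, by simp [h], by simp [h]⟩
  · by_cases h' : G.Adj x₁ x₀
    · obtain ⟨z, hz⟩ := hH.neighbor y₀
      exact ⟨z, by simp [h, hz.ne], by simp [h', hz]⟩
    · obtain ⟨z, hz, hz'⟩ := hH.nonneighbor y₀
      exact ⟨z, by simp [h, hz], by simp [h', hz']⟩

/-- A new vertex shows that its type over the pair occurs in G; the common profile then provides
that type in H. A repeated vertex is answered by the corresponding pebble. -/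
theorem exists_third (hG : HasExtensionProfile G P) (hH : HasExtensionProfile H P)
    {x₀ x₁ : V} {y₀ y₁ : V'} (he : x₁ = x₀ ↔ y₁ = y₀) (ha : G.Adj x₁ x₀ ↔ H.Adj y₁ y₀) (x₂ : V) :
    ∃ y₂, ((x₂ = x₀ ↔ y₂ = y₀) ∧ (G.Adj x₂ x₀ ↔ H.Adj y₂ y₀)) ∧
      ((x₂ = x₁ ↔ y₂ = y₁) ∧ (G.Adj x₂ x₁ ↔ H.Adj y₂ y₁)) := by
  classical
  by_cases h : x₁ = x₀
  · obtain ⟨y₂, h₂⟩ := hH.exists_second (G := G) x₀ x₂ y₀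
    exact ⟨y₂, h₂, by rw [h, he.1 h]; exact h₂⟩
  by_cases h₀ : x₂ = x₀
  · subst h₀
    exact ⟨y₀, by simp, by rw [eq_comm, he, eq_comm], by rw [G.adj_comm, ha, H.adj_comm]⟩
  by_cases h₁ : x₂ = x₁
  · subst h₁
    exact ⟨y₁, ⟨he, ha⟩, by simp, by simp⟩
  obtain ⟨z, z₁, z₀, a₁, a₀⟩ := (hH.extension y₁ y₀ (fun h' => h (he.2 h')) (decide (G.Adj x₁ x₀))
    (by simp [ha]) (decide (G.Adj x₂ x₁)) (decide (G.Adj x₂ x₀))).2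
    ((hG.extension x₁ x₀ h _ (by simp) _ _).1 ⟨x₂, h₁, h₀, by simp, by simp⟩)
  exact ⟨z, ⟨by simp [h₀, z₀], by simp [a₀]⟩, by simp [h₁, z₁], by simp [a₁]⟩

theorem snoc_snoc_snoc {U : Type*} (a b c : U) :
    (Fin.snoc (Fin.snoc (Fin.snoc (default : Fin 0 → U) a : Fin 1 → U) b : Fin 2 → U) c
      : Fin 3 → U) = ![a, b, c] := by
  ext i
  fin_cases i <;> rfl

theorem duplicatorWins_zero {x₀ x₁ x₂ : V} {y₀ y₁ y₂ : V'}
    (h₁₀ : (x₁ = x₀ ↔ y₁ = y₀) ∧ (G.Adj x₁ x₀ ↔ H.Adj y₁ y₀))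
    (h₂₀ : (x₂ = x₀ ↔ y₂ = y₀) ∧ (G.Adj x₂ x₀ ↔ H.Adj y₂ y₀))
    (h₂₁ : (x₂ = x₁ ↔ y₂ = y₁) ∧ (G.Adj x₂ x₁ ↔ H.Adj y₂ y₁)) :
    DuplicatorWins G H 0
      (Fin.snoc (Fin.snoc (Fin.snoc (default : Fin 0 → V) x₀ : Fin 1 → V) x₁ : Fin 2 → V) x₂
        : Fin 3 → V)
      (Fin.snoc (Fin.snoc (Fin.snoc (default : Fin 0 → V') y₀ : Fin 1 → V') y₁ : Fin 2 → V') y₂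
        : Fin 3 → V') := by
  rw [snoc_snoc_snoc, snoc_snoc_snoc]
  have s : ∀ {x x' : V} {y y' : V'}, (x = x' ↔ y = y') ∧ (G.Adj x x' ↔ H.Adj y y') →
      (x' = x ↔ y' = y) ∧ (G.Adj x' x ↔ H.Adj y' y) := by
    rintro x x' y y' ⟨h, h'⟩
    exact ⟨by rw [eq_comm, h, eq_comm], by rw [G.adj_comm, h', H.adj_comm]⟩
  intro i j
  fin_cases i <;> fin_cases j <;>
    first
    | exact h₁₀
    | exact h₂₀
    | exact h₂₁
    | exact s h₁₀
    | exact s h₂₀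
    | exact s h₂₁
    | exact ⟨by simp, by simp⟩

theorem duplicatorWins [Nonempty V] [Nonempty V'] (hG : HasExtensionProfile G P)
    (hH : HasExtensionProfile H P) :
    DuplicatorWins G H 3 (default : Fin 0 → V) default := by
  have second : ∀ {x₀ x₁ : V} {y₀ y₁ : V'},
      (x₁ = x₀ ↔ y₁ = y₀) ∧ (G.Adj x₁ x₀ ↔ H.Adj y₁ y₀) →
      DuplicatorWins G H 1
        (Fin.snoc (Fin.snoc (default : Fin 0 → V) x₀ : Fin 1 → V) x₁ : Fin 2 → V)
        (Fin.snoc (Fin.snoc (default : Fin 0 → V') y₀ : Fin 1 → V') y₁ : Fin 2 → V') := by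
    intro x₀ x₁ y₀ y₁ h
    refine ⟨fun x₂ => ?_, fun y₂ => ?_⟩
    · obtain ⟨y₂, h₀, h₁⟩ := exists_third hG hH h.1 h.2 x₂
      exact ⟨y₂, duplicatorWins_zero h h₀ h₁⟩
    · obtain ⟨x₂, h₀, h₁⟩ := exists_third hH hG h.1.symm h.2.symm y₂
      exact ⟨x₂, duplicatorWins_zero h ⟨h₀.1.symm, h₀.2.symm⟩ ⟨h₁.1.symm, h₁.2.symm⟩⟩
  have first : ∀ (x₀ : V) (y₀ : V'), DuplicatorWins G H 2
      (Fin.snoc (default : Fin 0 → V) x₀ : Fin 1 → V) (Fin.snoc (default : Fin 0 → V') y₀) := by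
    intro x₀ y₀
    refine ⟨fun x₁ => ?_, fun y₁ => ?_⟩
    · obtain ⟨y₁, h⟩ := hH.exists_second (G := G) x₀ x₁ y₀
      exact ⟨y₁, second h⟩
    · obtain ⟨x₁, h⟩ := hG.exists_second (G := H) y₀ y₁ x₀
      exact ⟨x₁, second ⟨h.1.symm, h.2.symm⟩⟩
  exact ⟨fun x => ⟨Classical.arbitrary V', first _ _⟩, fun y => ⟨Classical.arbitrary V, first _ _⟩⟩

/-- The complement has the profile with all adjacencies negated. -/
theorem compl (hG : HasExtensionProfile G P) :
    HasExtensionProfile Gᶜ (fun c a b => P (!c) (!a) (!b)) where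
  neighbor u := by
    obtain ⟨z, hz, hz'⟩ := hG.nonneighbor u
    exact ⟨z, by simp [hz, hz']⟩
  nonneighbor u := by
    obtain ⟨z, hz⟩ := hG.neighbor u
    exact ⟨z, hz.ne, by simp [hz]⟩
  extension u v huv c hc a b := by
    have flip : ∀ {x y : V} (d : Bool), x ≠ y → ((Gᶜ.Adj x y ↔ d = true) ↔
        (G.Adj x y ↔ (!d) = true)) := by
      intro x y d hxy
      cases d <;> simp [hxy]
    rw [← hG.extension u v huv (!c) ((flip c huv).1 hc) (!a) (!b)]
    refine exists_congr fun z => ?_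
    constructor
    · rintro ⟨h, h', h₁, h₂⟩
      exact ⟨h, h', (flip a h).1 h₁, (flip b h').1 h₂⟩
    · rintro ⟨h, h', h₁, h₂⟩
      exact ⟨h, h', (flip a h).2 h₁, (flip b h').2 h₂⟩

/-- Two graphs with the same profile agree on sentences of depth at most three, so a graph contained
in only one of them has depth at least four. -/
theorem four_le_inducedDepth {W : Type*} [Finite W] {F : SimpleGraph W} {V V' : Type}
    [Finite V] [Nonempty V] [Finite V'] [Nonempty V'] {G : SimpleGraph V} {H : SimpleGraph V'}
    (hG : HasExtensionProfile G P) (hH : HasExtensionProfile H P)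
    (hFG : F.IsIndContained G) (hFH : ¬ F.IsIndContained H) : 4 ≤ inducedDepth F := by
  -- Nonemptiness is essential: the infimum of the empty set of naturals is 0.
  obtain ⟨φ, hφ⟩ := exists_expresses F
  refine le_csInf ⟨_, φ, hφ, rfl⟩ ?_
  rintro d ⟨ψ, hψ, rfl⟩
  by_contra! hlt
  have := (hG.duplicatorWins hH).models_iff (φ := ψ) (by omega)
  exact hFH ((hψ V' H).1 (this.1 ((hψ V G).2 hFG)))

end HasExtensionProfile

open SimpleGraph

/-! ### Substitution into the pentagon. -/

/-- The pentagon with every vertex replaced by a copy of `X`. -/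
def pentagonSubst {V : Type*} (X : SimpleGraph V) : SimpleGraph (Fin 5 × V) where
  Adj p q := (cycleGraph 5).Adj p.1 q.1 ∨ p.1 = q.1 ∧ X.Adj p.2 q.2
  symm := ⟨fun _ _ h => h.imp (fun h => h.symm) (fun h => ⟨h.1.symm, h.2.symm⟩)⟩
  loopless := ⟨fun _ h => h.elim (fun h => h.ne rfl) (fun h => h.2.ne rfl)⟩

/-- Every vertex has a neighbour and a non-neighbour, and no neighbourhood is contained in that of
another vertex, up to that vertex itself. -/
structure HasIncomparableNeighborhoods {V : Type*} (X : SimpleGraph V) : Prop where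
  neighbor : ∀ u, ∃ z, X.Adj z u
  nonneighbor : ∀ u, ∃ z, z ≠ u ∧ ¬ X.Adj z u
  incomparable : ∀ u v, u ≠ v → ∃ z, z ≠ v ∧ X.Adj z u ∧ ¬ X.Adj z v

theorem hasIncomparableNeighborhoods_cycleGraph_five :
    HasIncomparableNeighborhoods (cycleGraph 5) := by
  constructor <;> decide

/-- The pentagon factor alone provides all witnesses, so F is arbitrary. Across different layers,
one of the two pentagon neighbours of i avoids j, which keeps the witness off the only possible
adjacency. -/
theorem hasIncomparableNeighborhoods_boxProd {W : Type*} (F : SimpleGraph W) :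
    HasIncomparableNeighborhoods (F □ cycleGraph 5) where
  neighbor := by
    rintro ⟨w, i⟩
    obtain ⟨j, hj⟩ := hasIncomparableNeighborhoods_cycleGraph_five.neighbor i
    exact ⟨(w, j), by simp [boxProd_adj, hj]⟩
  nonneighbor := by
    rintro ⟨w, i⟩
    obtain ⟨j, hj, hj'⟩ := hasIncomparableNeighborhoods_cycleGraph_five.nonneighbor i
    exact ⟨(w, j), by simp [hj], by simp [boxProd_adj, hj, hj']⟩
  incomparable := by
    rintro ⟨w, i⟩ ⟨x, j⟩ h
    by_cases hwx : w = x
    · subst hwx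
      obtain ⟨k, hk, hi, hj⟩ :=
        hasIncomparableNeighborhoods_cycleGraph_five.incomparable i j (by simpa using h)
      exact ⟨(w, k), by simp [hk], by simp [boxProd_adj, hi], by simp [boxProd_adj, hj]⟩
    · obtain ⟨k, hk, hj⟩ : ∃ k, (cycleGraph 5).Adj k i ∧ k ≠ j := by
        clear h
        revert i j
        decide
      exact ⟨(w, k), by simp [hwx], by simp [boxProd_adj, hk], by simp [boxProd_adj, hwx, hj]⟩

/-- Substituting into the pentagon a graph with incomparable neighbourhoods yields a graph in which
every pair of vertices has extensions of all adjacency types. -/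
theorem hasExtensionProfile_pentagonSubst {V : Type*} {X : SimpleGraph V}
    (hX : HasIncomparableNeighborhoods X) :
    HasExtensionProfile (pentagonSubst X) (fun _ _ _ => true) where
  neighbor := by
    rintro ⟨i, x⟩
    obtain ⟨z, hz⟩ := hX.neighbor x
    exact ⟨(i, z), Or.inr ⟨rfl, hz⟩⟩
  nonneighbor := by
    rintro ⟨i, x⟩
    obtain ⟨z, hz, hz'⟩ := hX.nonneighbor x
    exact ⟨(i, z), by simp [hz], by simp [pentagonSubst, hz']⟩
  extension := by
    rintro ⟨i, x⟩ ⟨j, y⟩ h c - a b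
    simp only [iff_true]
    by_cases hij : i = j
    · subst hij
      have hxy : x ≠ y := by simpa using h
      cases a <;> cases b
      · obtain ⟨k, hk, hk'⟩ := hasIncomparableNeighborhoods_cycleGraph_five.nonneighbor i
        exact ⟨(k, x), by simp [hk], by simp [hk], by simp [pentagonSubst, hk, hk'],
          by simp [pentagonSubst, hk, hk']⟩
      · obtain ⟨z, hz, h₁, h₂⟩ := hX.incomparable y x hxy.symm
        exact ⟨(i, z), by simp [hz], by simp [h₁.ne], by simp [pentagonSubst, h₂],
          by simp [pentagonSubst, h₁]⟩
      · obtain ⟨z, hz, h₁, h₂⟩ := hX.incomparable x y hxy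
        exact ⟨(i, z), by simp [h₁.ne], by simp [hz], by simp [pentagonSubst, h₁],
          by simp [pentagonSubst, h₂]⟩
      · obtain ⟨k, hk⟩ := hasIncomparableNeighborhoods_cycleGraph_five.neighbor i
        exact ⟨(k, x), by simp [hk.ne], by simp [hk.ne], by simp [pentagonSubst, hk],
          by simp [pentagonSubst, hk]⟩
    · by_cases hout : ∃ k, k ≠ i ∧ k ≠ j ∧ ((cycleGraph 5).Adj k i ↔ a = true) ∧
          ((cycleGraph 5).Adj k j ↔ b = true)
      · obtain ⟨k, hi, hj, hi', hj'⟩ := hout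
        exact ⟨(k, x), by simp [hi], by simp [hj], by simp [pentagonSubst, hi, hi'],
          by simp [pentagonSubst, hj, hj']⟩
      -- The only types missing in the pentagon are common neighbours of adjacent vertices and
      -- common non-neighbours of non-adjacent ones. A vertex in the same fibre as (i, x) supplies
      -- them, since it sees (j, y) exactly as i sees j.
      · obtain ⟨rfl, hadj⟩ : a = b ∧ ((cycleGraph 5).Adj i j ↔ a = true) := by
          clear h
          revert i j a b
          decide
        obtain ⟨z, hz, hz'⟩ : ∃ z, z ≠ x ∧ (X.Adj z x ↔ a = true) := by
          cases a
          · obtain ⟨z, hz, hz'⟩ := hX.nonneighbor x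
            exact ⟨z, hz, by simp [hz']⟩
          · obtain ⟨z, hz⟩ := hX.neighbor x
            exact ⟨z, hz.ne, by simp [hz]⟩
        exact ⟨(i, z), by simp [hz], by simp [hij], by simp [pentagonSubst, hz'],
          by simp [pentagonSubst, hij, hadj]⟩

theorem isIndContained_pentagonSubst {V : Type*} (X : SimpleGraph V) :
    X.IsIndContained (pentagonSubst X) :=
  ⟨⟨⟨fun x => (0, x), fun _ _ h => congrArg Prod.snd h⟩, by
    intro x y
    change (cycleGraph 5).Adj 0 0 ∨ 0 = 0 ∧ X.Adj x y ↔ _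
    simp⟩⟩

/-- A graph without nontrivial modules is contained in a substituted pentagon only if it is contained
in the pentagon or in the graph substituted. -/
theorem isIndContained_of_pentagonSubst {W V : Type*} [Fintype W] [DecidableEq W]
    {F : SimpleGraph W} {X : SimpleGraph V}
    (hF : ∀ T : Finset W, (∀ z ∉ T, ∀ x ∈ T, ∀ y ∈ T, F.Adj z x → F.Adj z y) →
      T.card ≤ 1 ∨ T = Finset.univ)
    (h : F.IsIndContained (pentagonSubst X)) :
    F.IsIndContained (cycleGraph 5) ∨ F.IsIndContained X := by
  obtain ⟨f⟩ := h
  have hf : ∀ {x y}, F.Adj x y ↔ (cycleGraph 5).Adj (f x).1 (f y).1 ∨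
      (f x).1 = (f y).1 ∧ X.Adj (f x).2 (f y).2 := fun {x y} => f.map_rel_iff.symm
  -- The fibres of the projection to the pentagon are modules of F.
  have fiber : ∀ i, (Finset.univ.filter fun w => (f w).1 = i).card ≤ 1 ∨
      (Finset.univ.filter fun w => (f w).1 = i) = Finset.univ := by
    intro i
    refine hF _ ?_
    simp only [Finset.mem_filter_univ]
    intro z hz x hx y hy
    rw [hf, hf, hx, hy]
    simp [hz]
  by_cases hall : ∃ i, (Finset.univ.filter fun w => (f w).1 = i) = Finset.univ
  · obtain ⟨i, hi⟩ := hall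
    have hi' : ∀ w, (f w).1 = i := by simpa [Finset.filter_eq_self] using hi
    refine Or.inr ⟨⟨⟨fun w => (f w).2, fun x y hxy => f.injective (Prod.ext ?_ hxy)⟩, ?_⟩⟩
    · rw [hi', hi']
    · intro x y
      change X.Adj (f x).2 (f y).2 ↔ _
      simp [hf, hi']
  · have inj : Function.Injective fun w => (f w).1 := by
      intro x y hxy
      have := (fiber (f y).1).resolve_right fun h => hall ⟨_, h⟩
      exact Finset.card_le_one.1 this x (by simpa using hxy) y (by simp)
    refine Or.inl ⟨⟨⟨_, inj⟩, ?_⟩⟩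
    intro x y
    simp only [Function.Embedding.coeFn_mk, hf]
    constructor
    · exact Or.inl
    · rintro (h | ⟨h, h'⟩)
      · exact h
      · rw [inj h] at h'
        exact (h'.ne rfl).elim
-- The concrete host graphs and five-vertex graphs.
/-- The `3 × 3` rook's graph, with the cells numbered row by row. -/
def rookGraph : SimpleGraph (Fin 9) :=
  SimpleGraph.fromRel fun i j => i.val / 3 = j.val / 3 ∨ i.val % 3 = j.val % 3

instance : DecidableRel rookGraph.Adj := by unfold rookGraph; infer_instance

/-- The Petersen graph: the outer pentagon on `0, …, 4`, the inner pentagram on `5, …, 9`. -/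
def petersenGraph : SimpleGraph (Fin 10) :=
  SimpleGraph.fromRel fun i j => j.val = i.val + 5 ∨ j.val < 5 ∧ j.val = (i.val + 1) % 5 ∧ i.val < 5 ∨
    5 ≤ i.val ∧ j.val = (i.val + 2) % 5 + 5

instance : DecidableRel petersenGraph.Adj := by unfold petersenGraph; infer_instance

/-- The Cayley graph of the cyclic group of order `13` with respect to `±1, ±5`. -/
def circulantThirteen : SimpleGraph (Fin 13) :=
  SimpleGraph.fromRel fun i j => j.val = (i.val + 1) % 13 ∨ j.val = (i.val + 5) % 13

instance : DecidableRel circulantThirteen.Adj := by unfold circulantThirteen; infer_instance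

theorem hasExtensionProfile_rookGraph : HasExtensionProfile rookGraph (fun _ _ _ => true) := by
  constructor <;> decide +kernel

theorem hasExtensionProfile_petersenGraph :
    HasExtensionProfile petersenGraph (fun c a b => !(c && a && b)) := by
  constructor <;> decide +kernel

theorem hasExtensionProfile_circulantThirteen :
    HasExtensionProfile circulantThirteen (fun c a b => !(c && a && b)) := by
  constructor <;> decide +kernel

/-- The path on five vertices. -/
def pathFive : SimpleGraph (Fin 5) :=
  SimpleGraph.fromRel fun i j => (i, j) ∈ [(0, 1), (1, 2), (2, 3), (3, 4)]

/-- The complement of the path on five vertices, as a path `0 - 1 - 2 - 3` and the vertex `4`. -/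
def house : SimpleGraph (Fin 5) :=
  SimpleGraph.fromRel fun i j => (i, j) ∈ [(0, 1), (1, 2), (2, 3), (4, 0), (4, 1), (4, 3)]

/-- A triangle with two pendant edges. -/
def bull : SimpleGraph (Fin 5) :=
  SimpleGraph.fromRel fun i j => (i, j) ∈ [(0, 1), (1, 2), (2, 3), (4, 1), (4, 2)]

/-- A cycle of length four together with an isolated vertex. -/
def fourCycleWithIsolated : SimpleGraph (Fin 5) :=
  SimpleGraph.fromRel fun i j => (i, j) ∈ [(0, 1), (1, 2), (2, 3), (3, 0)]

instance : DecidableRel pathFive.Adj := by unfold pathFive; infer_instance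
instance : DecidableRel house.Adj := by unfold house; infer_instance
instance : DecidableRel bull.Adj := by unfold bull; infer_instance
instance : DecidableRel fourCycleWithIsolated.Adj := by
  unfold fourCycleWithIsolated; infer_instance

/-! ### Five-vertex induced subgraphs of the rook's graph. -/

/-- The vertices `σ` induce a copy of `K`. -/
abbrev InducesCopy {V W : Type*} (G : SimpleGraph V) (K : SimpleGraph W) (σ : W → V) : Prop :=
  ∀ i j, (G.Adj (σ i) (σ j) ↔ K.Adj i j) ∧ (σ i = σ j → i = j)

theorem InducesCopy.isIndContained {V W : Type*} {G : SimpleGraph V} {K : SimpleGraph W}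
    {σ : W → V} (h : InducesCopy G K σ) : K.IsIndContained G :=
  ⟨⟨⟨σ, fun i j => (h i j).2⟩, fun {i j} => (h i j).1⟩⟩

-- A finite check. The path, house and bull share the induced path a, b, c, d and differ in e.
-- Interleaving adjacency conditions with the quantifiers prunes the search.
set_option synthInstance.maxHeartbeats 400000 in
set_option synthInstance.maxSize 4096 in
theorem fiveSubset_rookGraph : ∀ S ∈ (Finset.univ : Finset (Fin 9)).powersetCard 5,
    (∃ a ∈ S, ∃ b ∈ S, rookGraph.Adj a b ∧ ∃ c ∈ S, ¬ rookGraph.Adj a c ∧ c ≠ a ∧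
      rookGraph.Adj b c ∧ ∃ d ∈ S, rookGraph.Adj c d ∧ ¬ rookGraph.Adj b d ∧ d ≠ b ∧
      ¬ rookGraph.Adj a d ∧ ∃ e ∈ S,
        InducesCopy rookGraph pathFive ![a, b, c, d, e] ∨
        InducesCopy rookGraph house ![a, b, c, d, e] ∨
        InducesCopy rookGraph bull ![a, b, c, d, e]) ∨
    (∃ a ∈ S, ∃ b ∈ S, rookGraph.Adj a b ∧ ∃ c ∈ S, ¬ rookGraph.Adj a c ∧ c ≠ a ∧
      rookGraph.Adj b c ∧ ∃ d ∈ S, rookGraph.Adj c d ∧ rookGraph.Adj d a ∧ ∃ e ∈ S,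
        InducesCopy rookGraph fourCycleWithIsolated ![a, b, c, d, e]) ∨
    (∃ a ∈ S, ∃ b ∈ S, ¬ rookGraph.Adj a b ∧ a ≠ b ∧ ∃ c ∈ S, rookGraph.Adj a c ∧
      ¬ rookGraph.Adj b c ∧ ∃ d ∈ S, ¬ rookGraph.Adj c d ∧ rookGraph.Adj d b ∧ ∃ e ∈ S,
        InducesCopy rookGraph fourCycleWithIsolatedᶜ ![a, b, c, d, e]) := by
  decide +kernel

theorem isIndContained_of_inducesCopy_range {V W U : Type*} {G : SimpleGraph V} {F : SimpleGraph W}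
    {K : SimpleGraph U} {σ : U → V} (f : F ↪g G) (hσ : ∀ i, σ i ∈ Set.range f)
    (h : InducesCopy G K σ) : K.IsIndContained F := by
  choose g hg using hσ
  refine InducesCopy.isIndContained (σ := g) fun i j => ⟨?_, fun hij => (h i j).2 ?_⟩
  · rw [← (h i j).1, ← hg, ← hg, f.map_adj_iff]
  · rw [← hg, ← hg, hij]

theorem isIndContained_symm_of_card_eq {W U : Type*} [Fintype W] [Fintype U] {F : SimpleGraph W}
    {K : SimpleGraph U} (hc : Fintype.card U = Fintype.card W) (h : K.IsIndContained F) :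
    F.IsIndContained K := by
  obtain ⟨f⟩ := h
  have hb : Function.Bijective f := (Fintype.bijective_iff_injective_and_card f).2 ⟨f.injective, hc⟩
  exact ⟨(RelIso.ofSurjective f hb.2).symm.toRelEmbedding⟩

/-- The induced subgraphs of the rook's graph on five vertices. -/
theorem classification_of_isIndContained_rookGraph {W : Type*} [Fintype W]
    (hW : Fintype.card W = 5) {F : SimpleGraph W} (h : F.IsIndContained rookGraph) :
    pathFive.IsIndContained F ∨ house.IsIndContained F ∨ bull.IsIndContained F ∨
      fourCycleWithIsolated.IsIndContained F ∨ fourCycleWithIsolatedᶜ.IsIndContained F := by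
  obtain ⟨f⟩ := h
  have key := fiveSubset_rookGraph (Finset.univ.map f.toEmbedding) (by
    rw [Finset.mem_powersetCard]
    exact ⟨Finset.subset_univ _, by rw [Finset.card_map, Finset.card_univ, hW]⟩)
  have range : ∀ {a b c d e : Fin 9}, a ∈ Finset.univ.map f.toEmbedding →
      b ∈ Finset.univ.map f.toEmbedding → c ∈ Finset.univ.map f.toEmbedding →
      d ∈ Finset.univ.map f.toEmbedding → e ∈ Finset.univ.map f.toEmbedding →
      ∀ i, (![a, b, c, d, e] : Fin 5 → Fin 9) i ∈ Set.range f := by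
    intro a b c d e ha hb hc hd he i
    have mem : ∀ {x}, x ∈ Finset.univ.map f.toEmbedding → x ∈ Set.range f := by
      intro x hx
      simpa using hx
    fin_cases i
    exacts [mem ha, mem hb, mem hc, mem hd, mem he]
  rcases key with ⟨a, ha, b, hb, -, c, hc, -, -, -, d, hd, -, -, -, -, e, he, h | h | h⟩ |
    ⟨a, ha, b, hb, -, c, hc, -, -, -, d, hd, -, -, e, he, h⟩ |
    ⟨a, ha, b, hb, -, -, c, hc, -, -, d, hd, -, -, e, he, h⟩
  all_goals
    have := isIndContained_of_inducesCopy_range f (range ha hb hc hd he) h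
    tauto

/-! ### Absence from the substituted pentagon and from the Petersen graph. -/

theorem not_isIndContained_cycleGraph_five {K : SimpleGraph (Fin 5)} [DecidableRel K.Adj]
    (hK : ∃ i, K.degree i ≠ 2) : ¬ K.IsIndContained (cycleGraph 5) := by
  rintro ⟨f⟩
  obtain ⟨i, hi⟩ := hK
  have e : K ≃g cycleGraph 5 := RelIso.ofSurjective f (Finite.surjective_of_injective f.injective)
  have two : ∀ j, (cycleGraph 5).degree j = 2 := by decide
  exact hi ((e.degree_eq i).symm.trans (two _))

theorem not_isIndContained_pentagonSubst {K : SimpleGraph (Fin 5)} [DecidableRel K.Adj]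
    (hm : ∀ T : Finset (Fin 5), (∀ z ∉ T, ∀ x ∈ T, ∀ y ∈ T, K.Adj z x → K.Adj z y) →
      T.card ≤ 1 ∨ T = Finset.univ)
    (hK : ∃ i, K.degree i ≠ 2) : ¬ K.IsIndContained (pentagonSubst (cycleGraph 5)) := fun h =>
  (isIndContained_of_pentagonSubst hm h).elim (not_isIndContained_cycleGraph_five hK)
    (not_isIndContained_cycleGraph_five hK)

theorem pathFive_not_isIndContained_pentagonSubst :
    ¬ pathFive.IsIndContained (pentagonSubst (cycleGraph 5)) :=
  not_isIndContained_pentagonSubst (by decide +kernel) (by decide +kernel)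

theorem house_not_isIndContained_pentagonSubst :
    ¬ house.IsIndContained (pentagonSubst (cycleGraph 5)) :=
  not_isIndContained_pentagonSubst (by decide +kernel) (by decide +kernel)

theorem bull_not_isIndContained_pentagonSubst :
    ¬ bull.IsIndContained (pentagonSubst (cycleGraph 5)) :=
  not_isIndContained_pentagonSubst (by decide +kernel) (by decide +kernel)

theorem fourCycleWithIsolated_isIndContained_circulantThirteen :
    fourCycleWithIsolated.IsIndContained circulantThirteen :=
  -- The steps +5, -1, -5, +1 close a 4-cycle modulo 13; the vertex 2 differs from its vertices by
  -- ±2 or ±3.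
  InducesCopy.isIndContained (σ := ![0, 5, 4, 12, 2]) (by decide +kernel)

/-- This excludes 4-cycles, induced or not. -/
theorem petersenGraph_eq_of_common_neighbors : ∀ a c, a ≠ c → ∀ b, petersenGraph.Adj a b →
    petersenGraph.Adj b c → ∀ d, petersenGraph.Adj c d → petersenGraph.Adj d a → b = d := by
  decide +kernel

theorem fourCycleWithIsolated_not_isIndContained_petersenGraph :
    ¬ fourCycleWithIsolated.IsIndContained petersenGraph := by
  rintro ⟨f⟩
  have adj : ∀ i j, fourCycleWithIsolated.Adj i j → petersenGraph.Adj (f i) (f j) :=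
    fun i j h => f.map_adj_iff.2 h
  have := petersenGraph_eq_of_common_neighbors (f 0) (f 2) (fun h => absurd (f.injective h) (by decide))
    (f 1) (adj _ _ (by decide)) (adj _ _ (by decide)) (f 3) (adj _ _ (by decide))
    (adj _ _ (by decide))
  exact absurd (f.injective this) (by decide)

/-! ### Assembling the cases. -/

/-- Every graph on five vertices has depth at least four. -/
theorem four_le_inducedDepth_of_card_eq_five {W : Type*} [Fintype W] (hW : Fintype.card W = 5)
    (F : SimpleGraph W) : 4 ≤ inducedDepth F := by
  have hsubst := hasExtensionProfile_pentagonSubst hasIncomparableNeighborhoods_cycleGraph_five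
  have large : ∀ {V' : Type} [Finite V'] [Nonempty V'] {H : SimpleGraph V'},
      HasExtensionProfile H (fun _ _ _ => true) → ¬ F.IsIndContained H → 4 ≤ inducedDepth F := by
    intro V' _ _ H hH hFH
    -- The graphs compared must live in `Type`, while W may lie in any universe; hence the copy on
    -- `Fin 5`.
    let e := Fintype.equivFinOfCardEq hW
    let F' : SimpleGraph (Fin 5) := F.map e.toEmbedding
    have h₁ : F.IsIndContained F' := ⟨(Iso.map e F).toRelEmbedding⟩
    have h₂ : F'.IsIndContained (F' □ cycleGraph 5) := ⟨F'.boxProdLeft (cycleGraph 5) 0⟩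
    exact (hasExtensionProfile_pentagonSubst
      (hasIncomparableNeighborhoods_boxProd F')).four_le_inducedDepth hH
      ((h₁.trans h₂).trans (isIndContained_pentagonSubst _)) hFH
  by_cases hrook : F.IsIndContained rookGraph
  swap
  · exact large hasExtensionProfile_rookGraph hrook
  by_cases hpent : F.IsIndContained (pentagonSubst (cycleGraph 5))
  swap
  · exact large hsubst hpent
  have card : Fintype.card (Fin 5) = Fintype.card W := by simp [hW]
  rcases classification_of_isIndContained_rookGraph hW hrook with h | h | h | h | h
  · exact (pathFive_not_isIndContained_pentagonSubst (h.trans hpent)).elim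
  · exact (house_not_isIndContained_pentagonSubst (h.trans hpent)).elim
  · exact (bull_not_isIndContained_pentagonSubst (h.trans hpent)).elim
  · exact hasExtensionProfile_circulantThirteen.four_le_inducedDepth
      hasExtensionProfile_petersenGraph
      ((isIndContained_symm_of_card_eq card h).trans
        fourCycleWithIsolated_isIndContained_circulantThirteen)
      (fun h' => fourCycleWithIsolated_not_isIndContained_petersenGraph (h.trans h'))
  · exact hasExtensionProfile_circulantThirteen.compl.four_le_inducedDepth
      hasExtensionProfile_petersenGraph.compl
      ((isIndContained_symm_of_card_eq card h).trans
        fourCycleWithIsolated_isIndContained_circulantThirteen.compl)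
      (fun h' => fourCycleWithIsolated_not_isIndContained_petersenGraph (h.trans h').of_compl)

end FirstOrderComplexity

theorem theorem4 {W : Type*} [Fintype W] (hW : Fintype.card W = 5) (F : SimpleGraph W) :
    4 ≤ FirstOrderComplexity.inducedDepth F :=
  FirstOrderComplexity.four_le_inducedDepth_of_card_eq_five hW F
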